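/- Let $H$ be a commutative monoid with identity $1$ and zero element $0\neq 1$ that is cancellative, i.e. $ab=ac$ with $a\neq 0$ implies $b=c$. An ideal system on $H$ is a map $r:\mathcal P(H)\to\mathcal P(H)$, $X\mapsto X_r$, such that for all $X,Y\subseteq H$ and $c\in H$: $X\cup\{0\}\subseteq X_r$; $X\subseteq Y_r$ implies $X_r\subseteq Y_r$; $cX_r=(cX)_r$; and $cH\subseteq\{c\}_r$. Assume that $r$ is finitary, i.e. $X_r=\bigcup\{E_r : E\subseteq X \text{ finite}\}$ for all $X\subseteq H$. Let $\mathcal I_r(H)=\{X_r : X\subseteq H\}$ be the set of $r$-ideals, with the Zariski topology, whose subbasic open sets are $\mathbf U_r(x)=\{I\in\mathcal I_r(H) : x\notin I\}$, $x\in H$. Let $r\text{-}\mathrm{spec}(H)\subseteq\mathcal I_r(H)$ be the subspace of prime $r$-ideals, i.e. of those $P\in\mathcal I_r(H)$ for which $1\notin P$ and $a,b\notin P$ implies $ab\notin P$ (its induced topology is the usual Zariski topology, with closed sets $\{P : X\subseteq P\}$, $X\subseteq H$). A topological space is called spectral if it is $T_0$, quasi-compact and sober, and its quasi-compact open subsets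 are closed under finite intersections and form a basis. The constructible topology of a spectral space is the topology with basis the sets $U\setminus V$ with $U,V$ quasi-compact open, and a subset is proconstructible if it is closed in the constructible topology. Then $\mathcal I_r(H)$ is a spectral space, and $r\text{-}\mathrm{spec}(H)$ is proconstructible in $\mathcal I_r(H)$. In particular, $r\text{-}\mathrm{spec}(H)$ is itself a (nonempty) spectral space. -/

import Mathlib

open Topology

/-- An ideal system on a (commutative) monoid with zero `H`: a map `X ↦ X_r` on subsets of `H`
such that `X ∪ {0} ⊆ X_r`, `X ⊆ Y_r → X_r ⊆ Y_r`, `c X_r = (c X)_r` and `c H ⊆ {c}_r`. -/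
structure IdealSystem (H : Type*) [CommMonoidWithZero H] where
  /-- The map `X ↦ X_r`. -/
  cl : Set H → Set H
  union_zero_subset : ∀ X : Set H, X ∪ {0} ⊆ cl X
  cl_subset_of_subset_cl : ∀ X Y : Set H, X ⊆ cl Y → cl X ⊆ cl Y
  mul_cl : ∀ (c : H) (X : Set H), (fun h => c * h) '' cl X = cl ((fun h => c * h) '' X)
  principal_subset : ∀ c : H, Set.range (fun h => c * h) ⊆ cl {c}

namespace IdealSystem

variable {H : Type*} [CommMonoidWithZero H]

/-- `r` is finitary: `X_r` is the union of the `E_r` over all finite subsets `E ⊆ X`. -/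
def IsFinitary (r : IdealSystem H) : Prop :=
  ∀ X : Set H, r.cl X = ⋃ (E : Set H) (_ : E.Finite ∧ E ⊆ X), r.cl E

/-- `I` is an `r`-ideal: `I = X_r` for some subset `X`. -/
def IsIdeal (r : IdealSystem H) (I : Set H) : Prop :=
  ∃ X : Set H, I = r.cl X

/-- The set `𝓘_r(H)` of all `r`-ideals of `H`. -/
def Ideals (r : IdealSystem H) : Type _ :=
  {I : Set H // r.IsIdeal I}

/-- The subbasic open set `U_r(x) = {I : x ∉ I}` of `𝓘_r(H)`. -/
def basicOpen (r : IdealSystem H) (x : H) : Set r.Ideals :=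
  {I | x ∉ I.1}

/-- The Zariski topology on `𝓘_r(H)`, with subbasis the sets `U_r(x)`, `x ∈ H`. -/
instance zariskiTopology (r : IdealSystem H) : TopologicalSpace r.Ideals :=
  TopologicalSpace.generateFrom (Set.range r.basicOpen)

/-- The set `r-spec(H)` of prime `r`-ideals, as a subset of `𝓘_r(H)`: the complement of `P` is
multiplicatively closed, which includes `1 ∉ P`. Coerced to a type, it carries the topology induced
by `𝓘_r(H)`; see `isClosed_primes_iff`. -/
def primes (r : IdealSystem H) : Set r.Ideals :=
  {P | 1 ∉ P.1 ∧ ∀ a b : H, a ∉ P.1 → b ∉ P.1 → a * b ∉ P.1}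

/-- An `r`-ideal absorbs multiplication. -/
theorem mul_mem (r : IdealSystem H) (I : r.Ideals) {a : H} (b : H) (ha : a ∈ I.1) :
    a * b ∈ I.1 := by
  obtain ⟨I, X, rfl⟩ := I
  exact r.cl_subset_of_subset_cl {a} X (Set.singleton_subset_iff.2 ha)
    (r.principal_subset a ⟨b, rfl⟩)

/-- The induced topology on `r-spec(H)` is the usual Zariski topology: its closed sets are exactly
the sets `V_r(X) = {P : X ⊆ P}`, `X ⊆ H`. -/
theorem isClosed_primes_iff (r : IdealSystem H) (S : Set r.primes) :
    IsClosed S ↔ ∃ X : Set H, S = {P : r.primes | X ⊆ P.1.1} := by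
  have hU : ∀ x : H, IsOpen {P : r.primes | x ∉ P.1.1} := fun x =>
    (TopologicalSpace.isOpen_generateFrom_of_mem ⟨x, rfl⟩ :
      IsOpen (r.basicOpen x)).preimage continuous_subtype_val
  constructor
  · intro hS
    have key : ∀ T : Set r.Ideals, IsOpen T → ∀ P : r.primes, P.1 ∈ T →
        ∃ x, x ∉ P.1.1 ∧ ∀ Q : r.primes, x ∉ Q.1.1 → Q.1 ∈ T := by
      intro T hT
      induction hT with
      | basic T hT =>
        obtain ⟨x, rfl⟩ := hT
        exact fun P hP => ⟨x, hP, fun Q hQ => hQ⟩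
      | univ => exact fun P _ => ⟨1, P.2.1, fun Q _ => trivial⟩
      | inter A B _ _ hA hB =>
        intro P hP
        obtain ⟨x, hx, hx'⟩ := hA P hP.1
        obtain ⟨y, hy, hy'⟩ := hB P hP.2
        refine ⟨x * y, P.2.2 x y hx hy, fun Q hQ => ⟨hx' Q fun h => hQ (r.mul_mem Q.1 y h),
          hy' Q fun h => hQ ?_⟩⟩
        rw [mul_comm]
        exact r.mul_mem Q.1 x h
      | sUnion C _ hC =>
        rintro P ⟨A, hA, hP⟩
        obtain ⟨x, hx, hx'⟩ := hC A hA P hP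
        exact ⟨x, hx, fun Q hQ => ⟨A, hA, hx' Q hQ⟩⟩
    obtain ⟨T, hT, hTS⟩ := isOpen_induced_iff.1 hS.isOpen_compl
    have hTS' : ∀ Q : r.primes, Q.1 ∈ T ↔ Q ∉ S := fun Q => by
      have := Set.ext_iff.1 hTS Q
      simpa using this
    refine ⟨{x | ∀ Q ∈ S, x ∈ Q.1.1}, Set.ext fun P => ⟨fun hP x hx => hx P hP, fun hP => ?_⟩⟩
    by_contra hPS
    obtain ⟨x, hx, hx'⟩ := key T hT P ((hTS' P).2 hPS)
    refine hx (hP fun Q hQ => ?_)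
    by_contra hxQ
    exact (hTS' Q).1 (hx' Q hxQ) hQ
  · rintro ⟨X, rfl⟩
    have : {P : r.primes | X ⊆ P.1.1} = ⋂ x ∈ X, {P : r.primes | x ∉ P.1.1}ᶜ := by
      ext P
      simp [Set.subset_def]
    rw [this]
    exact isClosed_biInter fun x _ => (hU x).isClosed_compl

end IdealSystem

/-! For an ultrafilter `u` on the `r`-ideals, the elements lying in `u`-almost every ideal form a
set that is again an `r`-ideal: by finitarity, membership in a closure involves only finitely many
elements (`isIdeal_ultrafilter`). This limit lies in exactly those `U_r(x)` that belong to `u`, so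
`SpectralSpace.of_ultrafilter` applies. Primality is an intersection of Boolean conditions on the
`U_r(x)`, hence constructibly closed and inherited by limits; the criterion then applies directly to
`r-spec(H)` as well. -/

/-- Ultrafilter criterion for spectrality: a T₀ space with a subbasis `S` is spectral as soon as
every ultrafilter `u` admits a point lying in exactly those members of `S` that belong to `u`. -/
theorem SpectralSpace.of_ultrafilter {X : Type*} [t : TopologicalSpace X] [T0Space X]
    {S : Set (Set X)} (hS : t = TopologicalSpace.generateFrom S)
    (hlim : ∀ u : Ultrafilter X, ∃ x, ∀ U ∈ S, x ∈ U ↔ U ∈ u) : SpectralSpace X := by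
  have hB := TopologicalSpace.isTopologicalBasis_of_subbasis hS
  set B : Set (Set X) := (fun f => ⋂₀ f) '' {f | f.Finite ∧ f ⊆ S}
  have hlimB : ∀ u : Ultrafilter X, ∃ x, (u : Filter X) ≤ 𝓝 x ∧ ∀ b ∈ B, x ∈ b ↔ b ∈ u := by
    intro u
    obtain ⟨x, hx⟩ := hlim u
    have hxB : ∀ b ∈ B, x ∈ b ↔ b ∈ u := by
      rintro _ ⟨f, ⟨hf, hfS⟩, rfl⟩
      rw [← Ultrafilter.mem_coe]
      simp only [Set.mem_sInter, Filter.sInter_mem hf]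
      exact forall₂_congr fun U hU => hx U (hfS hU)
    refine ⟨x, fun V hV => ?_, hxB⟩
    obtain ⟨b, hb, hxb, hbV⟩ := hB.mem_nhds_iff.1 hV
    exact Filter.mem_of_superset ((hxB b hb).1 hxb) hbV
  have hBcomp : ∀ b ∈ B, IsCompact b := fun b hb =>
      isCompact_iff_ultrafilter_le_nhds.2 fun u hu => by
    obtain ⟨x, hux, hx⟩ := hlimB u
    exact ⟨x, (hx b hb).2 (Filter.le_principal_iff.1 hu), hux⟩
  have hco : ∀ U : Set X, IsOpen U → IsCompact U → ∃ C ⊆ B, C.Finite ∧ U = ⋃₀ C := by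
    intro U hU hUc
    obtain ⟨C, hCB, rfl⟩ := hB.open_eq_sUnion hU
    obtain ⟨D, hDC, hD, hCD⟩ :=
      hUc.elim_finite_subcover_image (b := C) (c := id) (fun b hb => hB.isOpen (hCB hb))
        (by rw [Set.sUnion_eq_biUnion]; rfl)
    refine ⟨D, hDC.trans hCB, hD, subset_antisymm ?_ (Set.sUnion_subset_sUnion hDC)⟩
    rwa [Set.sUnion_eq_biUnion (s := D)]
  have huniv : CompactSpace X := isCompact_univ_iff.1
    (hBcomp _ ⟨∅, ⟨Set.finite_empty, Set.empty_subset _⟩, Set.sInter_empty⟩)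
  have hsep : QuasiSeparatedSpace X := by
    refine ⟨fun U V hU hUc hV hVc => isCompact_iff_ultrafilter_le_nhds.2 fun u hu => ?_⟩
    obtain ⟨x, hux, hx⟩ := hlimB u
    -- A compact open set is a finite union of basic sets, and an ultrafilter containing such a
    -- union contains one of its members.
    have hmem : ∀ W : Set X, IsOpen W → IsCompact W → W ∈ u → x ∈ W := by
      intro W hW hWc hWu
      obtain ⟨C, hCB, hC, rfl⟩ := hco W hW hWc
      obtain ⟨b, hb, hbu⟩ := (Ultrafilter.finite_sUnion_mem_iff hC).1 hWu
      exact ⟨b, hb, (hx b (hCB hb)).2 hbu⟩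
    have huUV := Filter.le_principal_iff.1 hu
    exact ⟨x, ⟨hmem U hU hUc (Filter.mem_of_superset huUV Set.inter_subset_left),
      hmem V hV hVc (Filter.mem_of_superset huUV Set.inter_subset_right)⟩, hux⟩
  have hpre : PrespectralSpace X := .of_isTopologicalBasis hB hBcomp
  have hsober : QuasiSober X := by
    refine ⟨fun {Z} hZ hZc => ?_⟩
    -- The limit of an ultrafilter containing `Z` and all open sets meeting `Z` is a generic point
    -- of `Z`; irreducibility is the finite intersection property needed.
    obtain ⟨u, hu⟩ := Ultrafilter.exists_ultrafilter_of_finite_inter_nonempty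
      (insert Z {U | IsOpen U ∧ (Z ∩ U).Nonempty}) (fun T hT => by
        classical
        have := isIrreducible_iff_sInter.1 hZ (T.erase Z)
          (fun U hU => ((hT (Finset.mem_of_mem_erase hU)).resolve_left
            (Finset.ne_of_mem_erase hU)).1)
          (fun U hU => ((hT (Finset.mem_of_mem_erase hU)).resolve_left
            (Finset.ne_of_mem_erase hU)).2)
        refine this.mono fun y hy U hU => ?_
        by_cases h : U = Z
        · exact h ▸ hy.1
        · exact hy.2 U (Finset.mem_coe.2 (Finset.mem_erase.2 ⟨h, hU⟩)))
    obtain ⟨x, hux, hx⟩ := hlimB u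
    have hxZ : x ∈ Z :=
      isClosed_iff_ultrafilter.1 hZc x u hux (hu (Set.mem_insert _ _))
    refine ⟨x, subset_antisymm (closure_minimal (Set.singleton_subset_iff.2 hxZ) hZc)
      fun z hz => ?_⟩
    refine hB.mem_closure_iff.2 fun b hb hzb => ⟨x, ?_, rfl⟩
    exact (hx b hb).2 (hu (Or.inr ⟨hB.isOpen hb, z, hz, hzb⟩))
  exact {}

namespace IdealSystem

variable {H : Type*} [CommMonoidWithZero H] (r : IdealSystem H)

theorem subset_cl (X : Set H) : X ⊆ r.cl X :=
  Set.subset_union_left.trans (r.union_zero_subset X)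

theorem cl_eq_of_isIdeal {I : Set H} (hI : r.IsIdeal I) : r.cl I = I := by
  obtain ⟨X, rfl⟩ := hI
  exact subset_antisymm (r.cl_subset_of_subset_cl _ _ subset_rfl) (r.subset_cl _)

theorem isOpen_basicOpen (x : H) : IsOpen (r.basicOpen x) :=
  TopologicalSpace.isOpen_generateFrom_of_mem ⟨x, rfl⟩

instance : T0Space r.Ideals := by
  refine ⟨fun I J h => Subtype.ext (Set.ext fun x => not_iff_not.1 ?_)⟩
  exact h.mem_open_iff (r.isOpen_basicOpen x)

variable {r}

theorem IsFinitary.isIdeal_ultrafilter (hr : r.IsFinitary) (u : Ultrafilter r.Ideals) :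
    r.IsIdeal {x | ∀ᶠ I : r.Ideals in u, x ∈ I.1} := by
  refine ⟨_, subset_antisymm (r.subset_cl _) fun x hx => ?_⟩
  rw [hr] at hx
  simp only [Set.mem_iUnion] at hx
  obtain ⟨E, ⟨hE, hEA⟩, hxE⟩ := hx
  have hev : ∀ᶠ I : r.Ideals in u, ∀ y ∈ E, y ∈ I.1 :=
    (Filter.eventually_all_finite hE).2 fun y hy => hEA hy
  refine hev.mono fun I hI => ?_
  obtain ⟨X, hX⟩ := I.2
  rw [hX] at hI ⊢
  exact r.cl_subset_of_subset_cl E X hI hxE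

/-- The limit, in the constructible topology, of an ultrafilter on the set of `r`-ideals. -/
def IsFinitary.ultrafilterLim (hr : r.IsFinitary) (u : Ultrafilter r.Ideals) : r.Ideals :=
  ⟨_, hr.isIdeal_ultrafilter u⟩

theorem IsFinitary.ultrafilterLim_mem_basicOpen_iff (hr : r.IsFinitary)
    (u : Ultrafilter r.Ideals) (x : H) :
    hr.ultrafilterLim u ∈ r.basicOpen x ↔ r.basicOpen x ∈ u :=
  Ultrafilter.eventually_not.symm

theorem IsFinitary.spectralSpace_ideals (hr : r.IsFinitary) : SpectralSpace r.Ideals := by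
  refine SpectralSpace.of_ultrafilter rfl fun u => ⟨hr.ultrafilterLim u, ?_⟩
  rintro _ ⟨x, rfl⟩
  exact hr.ultrafilterLim_mem_basicOpen_iff u x

theorem IsFinitary.isCompact_basicOpen (hr : r.IsFinitary) (x : H) :
    IsCompact (r.basicOpen x) := by
  refine isCompact_iff_ultrafilter_le_nhds.2 fun u hu => ⟨hr.ultrafilterLim u,
    (hr.ultrafilterLim_mem_basicOpen_iff u x).2 (Filter.le_principal_iff.1 hu), ?_⟩
  rw [TopologicalSpace.nhds_generateFrom]
  simp only [le_iInf_iff, Filter.le_principal_iff]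
  rintro _ ⟨hI, y, rfl⟩
  exact (hr.ultrafilterLim_mem_basicOpen_iff u y).1 hI

theorem IsFinitary.isClosed_constructibleTopology_primes (hr : r.IsFinitary) :
    IsClosed[constructibleTopology r.Ideals] r.primes := by
  have hopen : ∀ x, IsOpen[constructibleTopology r.Ideals] (r.basicOpen x) := fun x =>
    (hr.isCompact_basicOpen x).isOpen_constructibleTopology_of_isOpen (r.isOpen_basicOpen x)
  have hopen' : ∀ x, IsOpen[constructibleTopology r.Ideals] (r.basicOpen x)ᶜ := fun x =>
    IsCompact.isOpen_constructibleTopology_of_isClosed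
      (by simpa using hr.isCompact_basicOpen x) (r.isOpen_basicOpen x).isClosed_compl
  have h : r.primes = r.basicOpen 1 ∩
      ⋂ a, ⋂ b, ((r.basicOpen a)ᶜ ∪ ((r.basicOpen b)ᶜ ∪ r.basicOpen (a * b))) := by
    ext P
    simp only [primes, basicOpen, Set.mem_ofPred_eq, Set.mem_inter_iff, Set.mem_iInter,
      Set.mem_union, Set.mem_compl_iff, imp_iff_not_or]
  rw [h]
  let := constructibleTopology r.Ideals
  have hU : ∀ x, IsClopen (r.basicOpen x) := fun x => ⟨⟨hopen' x⟩, hopen x⟩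
  exact (hU 1).isClosed.inter (isClosed_iInter fun a => isClosed_iInter fun b =>
    (hU a).compl.isClosed.union ((hU b).compl.isClosed.union (hU (a * b)).isClosed))

theorem IsFinitary.ultrafilterLim_mem_primes (hr : r.IsFinitary) {u : Ultrafilter r.Ideals}
    (hu : r.primes ∈ u) : hr.ultrafilterLim u ∈ r.primes := by
  have key := hr.ultrafilterLim_mem_basicOpen_iff u
  refine ⟨(key 1).2 (Filter.mem_of_superset hu fun P hP => hP.1), fun a b ha hb =>
    (key (a * b)).2 ?_⟩
  filter_upwards [hu, (key a).1 ha, (key b).1 hb] with P hP haP hbP using hP.2 a b haP hbP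

theorem IsFinitary.spectralSpace_primes (hr : r.IsFinitary) : SpectralSpace r.primes := by
  refine SpectralSpace.of_ultrafilter induced_generateFrom_eq fun u => ?_
  refine ⟨⟨hr.ultrafilterLim (u.map Subtype.val), hr.ultrafilterLim_mem_primes
    (Filter.mem_map.2 (Filter.mem_of_superset Filter.univ_mem fun P _ => P.2))⟩, ?_⟩
  rintro _ ⟨_, ⟨x, rfl⟩, rfl⟩
  exact hr.ultrafilterLim_mem_basicOpen_iff _ x

variable (r)

/-- Scaling by `0` fixes `{0}` and collapses its nonempty closure to `{0}`. This makes the zero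
ideal available as a prime. -/
theorem cl_singleton_zero : r.cl {0} = {0} := by
  have h := r.mul_cl 0 {0}
  have h0 : (0 : H) ∈ r.cl {0} := r.subset_cl _ rfl
  simpa [Set.Nonempty.image_const ⟨_, h0⟩] using h.symm

theorem nonempty_primes [Nontrivial H] [NoZeroDivisors H] : Nonempty r.primes :=
  ⟨⟨{0}, {0}, r.cl_singleton_zero.symm⟩, one_ne_zero, fun _ _ => mul_ne_zero⟩

end IdealSystem

theorem theorem3p8 {H : Type*} [CommMonoidWithZero H] [Nontrivial H] [IsCancelMulZero H]
    (r : IdealSystem H) (hr : r.IsFinitary) :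
    SpectralSpace r.Ideals ∧
      IsClosed[constructibleTopology r.Ideals] r.primes ∧
      SpectralSpace r.primes ∧ Nonempty r.primes := by
  exact ⟨hr.spectralSpace_ideals, hr.isClosed_constructibleTopology_primes,
    hr.spectralSpace_primes, r.nonempty_primes⟩
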